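/- Let $K$ be a field with a nonarchimedean valuation $\mathrm{val}:K^*\to\mathbb{R}$ (with $\mathrm{val}(0)=\infty$) whose residue field has characteristic different from $2$ and $3$, and fix an extension of $\mathrm{val}$ to a real-valued valuation on the algebraic closure $\overline{K}$, again denoted $\mathrm{val}$. A ternary cubic $f=\sum_{i+j+k=3}c_{ijk}\,x^iy^jz^k$ over $\overline{K}$ is said to be in symmetric honeycomb form if the denominators of the following ratios are nonzero, the six ratios $$\frac{c_{021}c_{102}}{c_{111}c_{012}},\ \frac{c_{012}c_{120}}{c_{111}c_{021}},\ \frac{c_{201}c_{012}}{c_{111}c_{102}},\ \frac{c_{210}c_{021}}{c_{111}c_{120}},\ \frac{c_{102}c_{210}}{c_{111}c_{201}},\ \frac{c_{120}c_{201}}{c_{111}c_{210}}$$ have the same positive valuation, and the three ratios $$\frac{c_{111}c_{003}}{c_{012}c_{102}},\ \frac{c_{111}c_{030}}{c_{021}c_{120}},\ \frac{c_{111}c_{300}}{c_{201}c_{210}}$$ have the same positive (possibly infinite) valuation. For a ternary cubic $f$, let $c_4(f)$ and $c_6(f)$ be its Aronhold invariants of degrees $4$ and $6$, normalized so that on Weierstrass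 cubics they are the usual $c_4$ and $c_6$, and let $\Delta(f)=(c_4(f)^3-c_6(f)^2)/1728$ be its discriminant; when $\Delta(f)\neq 0$, its $j$-invariant is $j(f)=c_4(f)^3/\Delta(f)$. **Proposition.** Let $\iota,a\in K$ with $\mathrm{val}(\iota)<0$ and $\mathrm{val}(a)+\mathrm{val}(\iota)>0$. For $b\in\overline{K}$ put $$g_b = a\,(x^3+y^3+z^3)+b\,(x^2y+x^2z+xy^2+xz^2+y^2z+yz^2)+xyz .$$ Then: 1. There are exactly six elements $b\in\overline{K}$ such that $g_b$ is nonsingular with $j(g_b)=\iota$ and is in symmetric honeycomb form. 2. There is a polynomial $P\in K[X]$ of degree $12$, obtained from the equation $j(g_b)=\iota$ by clearing the denominator (that is, $P(b)=c_4(g_b)^3-\iota\,\Delta(g_b)$ for all $b\in\overline{K}$), such that for every $b\in\overline{K}$ one has $P(b)=0$ if and only if $g_b$ is nonsingular with $j(g_b)=\iota$. In particular, the six elements in (1) are roots of $P$. 3. Each of the six elements $b$ in (1) satisfies $\mathrm{val}(b)=-\mathrm{val}(\iota)/6$. -/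

import Mathlib

/-- A ternary cubic form
`c300 x³ + c210 x²y + c120 xy² + c030 y³ + c021 y²z + c012 yz² + c003 z³ + c102 xz² + c201 x²z
+ c111 xyz`, given by its ten coefficients. -/
@[ext]
structure TernaryCubic (F : Type*) where
  c300 : F
  c210 : F
  c120 : F
  c030 : F
  c021 : F
  c012 : F
  c003 : F
  c102 : F
  c201 : F
  c111 : F

namespace TernaryCubic

section Polynomial

variable {R : Type*} [CommRing R]

/-- The cubic as a homogeneous polynomial in the variables `x = X 0`, `y = X 1`, `z = X 2`. -/
noncomputable def toMvPolynomial (f : TernaryCubic R) : MvPolynomial (Fin 3) R :=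
  let x : MvPolynomial (Fin 3) R := MvPolynomial.X 0
  let y : MvPolynomial (Fin 3) R := MvPolynomial.X 1
  let z : MvPolynomial (Fin 3) R := MvPolynomial.X 2
  MvPolynomial.C f.c300 * x ^ 3 + MvPolynomial.C f.c210 * (x ^ 2 * y)
    + MvPolynomial.C f.c120 * (x * y ^ 2) + MvPolynomial.C f.c030 * y ^ 3
    + MvPolynomial.C f.c021 * (y ^ 2 * z) + MvPolynomial.C f.c012 * (y * z ^ 2)
    + MvPolynomial.C f.c003 * z ^ 3 + MvPolynomial.C f.c102 * (x * z ^ 2)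
    + MvPolynomial.C f.c201 * (x ^ 2 * z) + MvPolynomial.C f.c111 * (x * y * z)

/-- The symmetric cubic
`a (x³ + y³ + z³) + b (x²y + x²z + xy² + xz² + y²z + yz²) + xyz`. -/
def symmetricCubic (a b : R) : TernaryCubic R where
  c300 := a
  c210 := b
  c120 := b
  c030 := a
  c021 := b
  c012 := b
  c003 := a
  c102 := b
  c201 := b
  c111 := 1

theorem toMvPolynomial_symmetricCubic (a b : R) :
    (symmetricCubic a b).toMvPolynomial =
      let x : MvPolynomial (Fin 3) R := MvPolynomial.X 0
      let y : MvPolynomial (Fin 3) R := MvPolynomial.X 1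
      let z : MvPolynomial (Fin 3) R := MvPolynomial.X 2
      MvPolynomial.C a * (x ^ 3 + y ^ 3 + z ^ 3)
        + MvPolynomial.C b *
          (x ^ 2 * y + x ^ 2 * z + x * y ^ 2 + x * z ^ 2 + y ^ 2 * z + y * z ^ 2)
        + x * y * z := by
  simp only [toMvPolynomial, symmetricCubic, map_one]
  ring

/-- The Aronhold invariant of degree 4 of a ternary cubic (25 terms), normalized so that on
Weierstrass cubics it is the usual `c₄`. -/
def c₄ (f : TernaryCubic R) : R :=
  f.c111 ^ 4
    - 8 * f.c111 ^ 2 * (f.c210 * f.c012 + f.c120 * f.c102 + f.c021 * f.c201)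
    + 24 * f.c111 * (f.c300 * f.c021 * f.c012 + f.c210 * f.c120 * f.c003 + f.c210 * f.c021 *
      f.c102 + f.c120 * f.c012 * f.c201 + f.c030 * f.c102 * f.c201)
    - 216 * f.c111 * (f.c300 * f.c030 * f.c003)
    - 16 * (f.c210 * f.c120 * f.c012 * f.c102 + f.c210 * f.c021 * f.c012 * f.c201 + f.c120 *
      f.c021 * f.c102 * f.c201)
    + 16 * (f.c210 ^ 2 * f.c012 ^ 2 + f.c120 ^ 2 * f.c102 ^ 2 + f.c021 ^ 2 * f.c201 ^ 2)
    - 48 * (f.c300 * f.c120 * f.c012 ^ 2 + f.c300 * f.c021 ^ 2 * f.c102 + f.c210 ^ 2 * f.c021 *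
      f.c003 + f.c210 * f.c030 * f.c102 ^ 2 + f.c120 ^ 2 * f.c003 * f.c201 + f.c030 * f.c012 *
      f.c201 ^ 2)
    + 144 * (f.c300 * f.c120 * f.c021 * f.c003 + f.c300 * f.c030 * f.c012 * f.c102 + f.c210
      * f.c030 * f.c003 * f.c201)

/-- The Aronhold invariant of degree 6 of a ternary cubic (103 terms), normalized so that on
Weierstrass cubics it is the usual `c₆`. -/
def c₆ (f : TernaryCubic R) : R :=
  -f.c111 ^ 6
    + 12 * f.c111 ^ 4 * (f.c210 * f.c012 + f.c120 * f.c102 + f.c021 * f.c201)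
    - 36 * f.c111 ^ 3 * (f.c300 * f.c021 * f.c012 + f.c210 * f.c120 * f.c003 + f.c210 * f.c021
      * f.c102 + f.c120 * f.c012 * f.c201 + f.c030 * f.c102 * f.c201)
    - 540 * f.c111 ^ 3 * (f.c300 * f.c030 * f.c003)
    - 24 * f.c111 ^ 2 * (f.c210 * f.c120 * f.c012 * f.c102 + f.c210 * f.c021 * f.c012 * f.c201
      + f.c120 * f.c021 * f.c102 * f.c201)
    - 48 * f.c111 ^ 2 * (f.c210 ^ 2 * f.c012 ^ 2 + f.c120 ^ 2 * f.c102 ^ 2 + f.c021 ^ 2 * f.c201 ^ 2)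
    + 72 * f.c111 ^ 2 * (f.c300 * f.c120 * f.c012 ^ 2 + f.c300 * f.c021 ^ 2 * f.c102 + f.c210 ^ 2 *
      f.c021 * f.c003 + f.c210 * f.c030 * f.c102 ^ 2 + f.c120 ^ 2 * f.c003 * f.c201 + f.c030 *
      f.c012 * f.c201 ^ 2)
    + 648 * f.c111 ^ 2 * (f.c300 * f.c120 * f.c021 * f.c003 + f.c300 * f.c030 * f.c012 *
      f.c102 + f.c210 * f.c030 * f.c003 * f.c201)
    + 144 * f.c111 * (f.c300 * f.c210 * f.c021 * f.c012 ^ 2 + f.c300 * f.c021 ^ 2 * f.c012 *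
      f.c201 + f.c210 ^ 2 * f.c120 * f.c012 * f.c003 + f.c210 ^ 2 * f.c021 * f.c012 * f.c102 +
      f.c210 * f.c120 ^ 2 * f.c003 * f.c102 + f.c210 * f.c120 * f.c021 * f.c102 ^ 2 + f.c210 *
      f.c120 * f.c012 ^ 2 * f.c201 + f.c210 * f.c021 ^ 2 * f.c102 * f.c201 + f.c120 ^ 2 * f.c012 *
      f.c102 * f.c201 + f.c120 * f.c030 * f.c102 ^ 2 * f.c201 + f.c120 * f.c021 * f.c012 *
      f.c201 ^ 2 + f.c030 * f.c021 * f.c102 * f.c201 ^ 2)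
    - 720 * f.c111 * (f.c300 * f.c120 * f.c021 * f.c012 * f.c102 + f.c210 * f.c120 * f.c021
      * f.c003 * f.c201 + f.c210 * f.c030 * f.c012 * f.c102 * f.c201)
    - 864 * f.c111 * (f.c300 * f.c210 * f.c021 ^ 2 * f.c003 + f.c300 * f.c120 ^ 2 * f.c012 *
      f.c003 + f.c300 * f.c030 * f.c021 * f.c102 ^ 2 + f.c300 * f.c030 * f.c012 ^ 2 * f.c201 +
      f.c210 ^ 2 * f.c030 * f.c003 * f.c102 + f.c120 * f.c030 * f.c003 * f.c201 ^ 2)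
    + 1296 * f.c111 * (f.c300 * f.c210 * f.c030 * f.c012 * f.c003 + f.c300 * f.c120 * f.c030
      * f.c003 * f.c102 + f.c300 * f.c030 * f.c021 * f.c003 * f.c201)
    - 48 * (f.c210 * f.c120 * f.c021 * f.c012 * f.c102 * f.c201)
    + 64 * (f.c210 ^ 3 * f.c012 ^ 3 + f.c120 ^ 3 * f.c102 ^ 3 + f.c021 ^ 3 * f.c201 ^ 3)
    - 96 * (f.c210 ^ 2 * f.c120 * f.c012 ^ 2 * f.c102 + f.c210 ^ 2 * f.c021 * f.c012 ^ 2 * f.c201 +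
      f.c210 * f.c120 ^ 2 * f.c012 * f.c102 ^ 2 + f.c210 * f.c021 ^ 2 * f.c012 * f.c201 ^ 2 + f.c120 ^ 2
      * f.c021 * f.c102 ^ 2 * f.c201 + f.c120 * f.c021 ^ 2 * f.c102 * f.c201 ^ 2)
    + 144 * (f.c300 * f.c210 * f.c021 ^ 2 * f.c012 * f.c102 + f.c300 * f.c120 * f.c021 *
      f.c012 ^ 2 * f.c201 + f.c210 ^ 2 * f.c120 * f.c021 * f.c003 * f.c102 + f.c210 * f.c120 ^ 2 *
      f.c012 * f.c003 * f.c201 + f.c210 * f.c030 * f.c021 * f.c102 ^ 2 * f.c201 + f.c120 *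
      f.c030 * f.c012 * f.c102 * f.c201 ^ 2)
    - 216 * (f.c300 ^ 2 * f.c021 ^ 2 * f.c012 ^ 2 + f.c210 ^ 2 * f.c120 ^ 2 * f.c003 ^ 2 + f.c210 ^ 2 *
      f.c021 ^ 2 * f.c102 ^ 2 + f.c120 ^ 2 * f.c012 ^ 2 * f.c201 ^ 2 + f.c030 ^ 2 * f.c102 ^ 2 * f.c201 ^ 2)
    - 288 * (f.c300 * f.c210 * f.c120 * f.c012 ^ 3 + f.c300 * f.c021 ^ 3 * f.c102 * f.c201 +
      f.c210 ^ 3 * f.c021 * f.c012 * f.c003 + f.c210 * f.c120 * f.c030 * f.c102 ^ 3 + f.c120 ^ 3 *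
      f.c003 * f.c102 * f.c201 + f.c030 * f.c021 * f.c012 * f.c201 ^ 3)
    + 576 * (f.c300 * f.c120 ^ 2 * f.c012 ^ 2 * f.c102 + f.c300 * f.c120 * f.c021 ^ 2 * f.c102 ^ 2 +
      f.c210 ^ 2 * f.c030 * f.c012 * f.c102 ^ 2 + f.c210 ^ 2 * f.c021 ^ 2 * f.c003 * f.c201 + f.c210 *
      f.c030 * f.c012 ^ 2 * f.c201 ^ 2 + f.c120 ^ 2 * f.c021 * f.c003 * f.c201 ^ 2)
    - 864 * (f.c300 * f.c210 * f.c030 * f.c012 ^ 2 * f.c102 + f.c300 * f.c120 ^ 2 * f.c021 *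
      f.c003 * f.c102 + f.c300 * f.c120 * f.c030 * f.c012 * f.c102 ^ 2 + f.c300 * f.c120 *
      f.c021 ^ 2 * f.c003 * f.c201 + f.c210 ^ 2 * f.c030 * f.c012 * f.c003 * f.c201 + f.c210 *
      f.c030 * f.c021 * f.c003 * f.c201 ^ 2)
    + 864 * (f.c300 ^ 2 * f.c030 * f.c012 ^ 3 + f.c300 ^ 2 * f.c021 ^ 3 * f.c003 + f.c300 * f.c120 ^ 3
      * f.c003 ^ 2 + f.c300 * f.c030 ^ 2 * f.c102 ^ 3 + f.c210 ^ 3 * f.c030 * f.c003 ^ 2 + f.c030 ^ 2 *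
      f.c003 * f.c201 ^ 3)
    + 1296 * (f.c300 * f.c210 * f.c120 * f.c021 * f.c012 * f.c003 + f.c300 * f.c210 * f.c030
      * f.c021 * f.c003 * f.c102 + f.c300 * f.c120 * f.c030 * f.c012 * f.c003 * f.c201 +
      f.c300 * f.c030 * f.c021 * f.c012 * f.c102 * f.c201 + f.c210 * f.c120 * f.c030 * f.c003
      * f.c102 * f.c201)
    - 3888 * (f.c300 ^ 2 * f.c030 * f.c021 * f.c012 * f.c003 + f.c300 * f.c210 * f.c120 *
      f.c030 * f.c003 ^ 2 + f.c300 * f.c030 ^ 2 * f.c003 * f.c102 * f.c201)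
    + 5832 * (f.c300 ^ 2 * f.c030 ^ 2 * f.c003 ^ 2)

end Polynomial

section Field

variable {F : Type*} [Field F]

/-- The discriminant of a ternary cubic over a field of characteristic different from 2 and 3,
normalized so that on Weierstrass cubics it is the usual `Δ`. As a polynomial in the ten
coefficients it is homogeneous of degree 12, with integer coefficients and 2040 terms. The cubic
curve is nonsingular exactly when it does not vanish. -/
def disc (f : TernaryCubic F) : F :=
  (f.c₄ ^ 3 - f.c₆ ^ 2) / 1728

/-- The `j`-invariant of a ternary cubic over a field of characteristic different from 2 and 3;
it is meaningful when `f.disc ≠ 0`. -/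
def jInvariant (f : TernaryCubic F) : F :=
  f.c₄ ^ 3 / f.disc

/-- The cubic is nonsingular, so that its `j`-invariant is defined, and the latter equals `ι`. -/
def HasJInvariant (f : TernaryCubic F) (ι : F) : Prop :=
  f.disc ≠ 0 ∧ f.jInvariant = ι

end Field

section Weierstrass

/-- The homogeneous Weierstrass cubic
`y²z + a₁xyz + a₃yz² - x³ - a₂x²z - a₄xz² - a₆z³`. -/
def ofWeierstrass {R : Type*} [CommRing R] (W : WeierstrassCurve R) : TernaryCubic R where
  c300 := -1
  c210 := 0
  c120 := 0
  c030 := 0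
  c021 := 1
  c012 := W.a₃
  c003 := -W.a₆
  c102 := -W.a₄
  c201 := -W.a₂
  c111 := W.a₁

theorem c₄_ofWeierstrass {R : Type*} [CommRing R] (W : WeierstrassCurve R) :
    (ofWeierstrass W).c₄ = W.c₄ := by
  simp only [c₄, ofWeierstrass, WeierstrassCurve.c₄, WeierstrassCurve.b₂, WeierstrassCurve.b₄]
  ring

theorem c₆_ofWeierstrass {R : Type*} [CommRing R] (W : WeierstrassCurve R) :
    (ofWeierstrass W).c₆ = W.c₆ := by
  simp only [c₆, ofWeierstrass, WeierstrassCurve.c₆, WeierstrassCurve.b₂, WeierstrassCurve.b₄,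
    WeierstrassCurve.b₆]
  ring

/-- The `j`-invariant defined above is the classical one. -/
theorem jInvariant_ofWeierstrass {F : Type*} [Field F] (h2 : (2 : F) ≠ 0) (h3 : (3 : F) ≠ 0)
    (W : WeierstrassCurve F) [W.IsElliptic] : (ofWeierstrass W).jInvariant = W.j := by
  have h : (1728 : F) ≠ 0 := by
    have : (1728 : F) = 2 ^ 6 * 3 ^ 3 := by norm_num
    rw [this]
    exact mul_ne_zero (pow_ne_zero _ h2) (pow_ne_zero _ h3)
  have hD : (ofWeierstrass W).disc = W.Δ := by
    rw [disc, c₄_ofWeierstrass, c₆_ofWeierstrass, ← W.c_relation, mul_div_cancel_left₀ _ h]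
  rw [jInvariant, hD, c₄_ofWeierstrass, WeierstrassCurve.j, Units.val_inv_eq_inv_val,
    WeierstrassCurve.coe_Δ', div_eq_inv_mul]

end Weierstrass

section Honeycomb

variable {F : Type*} [Field F]

/-- The six ratios whose valuations are the lattice lengths of the sides of the hexagon. -/
def hexagonRatios (f : TernaryCubic F) : Fin 6 → F :=
  ![f.c021 * f.c102 / (f.c111 * f.c012), f.c012 * f.c120 / (f.c111 * f.c021),
    f.c201 * f.c012 / (f.c111 * f.c102), f.c210 * f.c021 / (f.c111 * f.c120),
    f.c102 * f.c210 / (f.c111 * f.c201), f.c120 * f.c201 / (f.c111 * f.c210)]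

/-- The three ratios whose valuations are the lattice lengths of the bounded segments coming off
the hexagon. -/
def legRatios (f : TernaryCubic F) : Fin 3 → F :=
  ![f.c111 * f.c003 / (f.c012 * f.c102), f.c111 * f.c030 / (f.c021 * f.c120),
    f.c111 * f.c300 / (f.c201 * f.c210)]

/-- All nine ratios are defined, that is, none of their denominators vanishes. -/
def RatiosDefined (f : TernaryCubic F) : Prop :=
  f.c111 ≠ 0 ∧ f.c210 ≠ 0 ∧ f.c120 ≠ 0 ∧ f.c021 ≠ 0 ∧ f.c012 ≠ 0 ∧ f.c102 ≠ 0 ∧ f.c201 ≠ 0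

/-- Symmetric honeycomb form: the six hexagon ratios have the same positive valuation, and the
three leg ratios have the same positive valuation, where `0` has valuation `⊤`. -/
def IsSymmetricHoneycomb (v : AddValuation F (WithTop ℝ)) (f : TernaryCubic F) : Prop :=
  f.RatiosDefined ∧
    (∃ p : WithTop ℝ, 0 < p ∧ ∀ i, v (f.hexagonRatios i) = p) ∧
    (∃ q : WithTop ℝ, 0 < q ∧ ∀ i, v (f.legRatios i) = q)

end Honeycomb

end TernaryCubic

/-- The characteristic of the residue field of `v`. -/
noncomputable def residueChar {F : Type*} [Field F] (v : AddValuation F (WithTop ℝ)) : ℕ :=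
  ringChar (IsLocalRing.ResidueField (AddValuation.toValuation v).valuationSubring)

/-! For a symmetric cubic every hexagon ratio is `b` and every leg ratio is `a / b²`, so honeycomb
form means `b ≠ 0`, `val b > 0` and `val (a / b²) > 0`.

Choose `c` with `c⁶ = ι⁻¹` and write `b = c u`, `a = c² g`. The hypotheses put `c` and `g` in the
maximal ideal. The discriminant is `c⁶` times a polynomial in `u` with integral coefficients
(`disc_symmetricCubic`), so `j = ι` becomes an integral equation in `u` whose reduction is `1 - u⁶ =
0` (`jPolynomial_zero`). As 6 is a unit, this is separable with six roots over the algebraically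
closed residue field, and simple roots lift (`ncard_setOf_eval_eq_zero`). The six lifts are units,
hence give honeycomb forms.

Conversely, in honeycomb form `c₄` is a unit and the discriminant is `b⁶` times a unit, so `val ι =
-6 val b`. Thus `b / c` is integral and no solution is missed.

The polynomial `P` detects nonsingularity too, because `c₄` and the discriminant have no common zero
when `6 a ≠ 1`. -/

open Polynomial IsLocalRing

/-! ### Lifting roots from the residue field of a valuation ring -/

namespace ValuationSubring

variable {L : Type*} [Field L] [IsAlgClosed L] (A : ValuationSubring L)

/-- Simple roots lift from the residue field of a valuation ring of an algebraically closed
field. -/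
theorem exists_eval_eq_zero_of_residue {Q : A[X]} {x : A} (h0 : residue A (Q.eval x) = 0)
    (h1 : residue A (Q.derivative.eval x) ≠ 0) :
    ∃ r : A, Q.eval r = 0 ∧ residue A r = residue A x := by
  by_contra! hne
  have hx : Q.eval x ≠ 0 := fun h => hne x h rfl
  have hinj : Function.Injective (algebraMap A L) := Subtype.val_injective
  set QL := Q.map (algebraMap A L) with hQL
  have hev (y : A) : QL.eval (y : L) = (Q.eval y : A) := eval_map_apply (algebraMap A L) y
  have hx' : QL.eval (x : L) ≠ 0 := by
    rw [hev]
    exact fun h => hx (hinj h)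
  -- The logarithmic derivative `Q'(x) / Q(x)` is the sum of `1 / (x - z)` over the roots `z`. If no
  -- root in the ring reduces to the residue of `x`, every term is integral, so `Q(x)` divides
  -- `Q'(x)` in the ring, although only the former reduces to zero.
  have hsum := (IsAlgClosed.splits QL).eval_derivative_div_eval_of_ne_zero hx'
  have hmem : (QL.roots.map fun z => 1 / ((x : L) - z)).sum ∈ A := by
    refine multiset_sum_mem _ fun y hy => ?_
    obtain ⟨r, hr, rfl⟩ := Multiset.mem_map.1 hy
    rw [one_div]
    by_contra hinv
    have hA : (x : L) - r ∈ A := (A.mem_or_inv_mem _).resolve_right hinv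
    set d : A := ⟨(x : L) - r, hA⟩ with hd
    have hdr : ((x - d : A) : L) = r := by simp [hd]
    have hdu : residue A d = 0 := by
      rw [residue_eq_zero_iff, mem_maximalIdeal, _root_.mem_nonunits_iff]
      rintro ⟨u, hu⟩
      refine hinv ?_
      have hmul : (d : L) * ((u⁻¹ : Aˣ) : A) = 1 := by
        rw [← hu]
        exact_mod_cast congrArg (Subtype.val) u.mul_inv
      rw [inv_eq_of_mul_eq_one_right hmul]
      exact Subtype.property _
    refine hne (x - d) (hinj ?_) (by rw [map_sub, hdu, sub_zero])
    rw [map_zero]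
    change ((Q.eval (x - d) : A) : L) = 0
    rw [← hev, hdr]
    exact isRoot_of_mem_roots hr
  have hder : QL.derivative.eval (x : L) = (Q.derivative.eval x : A) := by
    rw [hQL, derivative_map]
    exact eval_map_apply (algebraMap A L) x
  rw [div_eq_iff hx', hder, hev] at hsum
  have hA : Q.derivative.eval x = ⟨_, hmem⟩ * Q.eval x := hinj hsum
  exact h1 (by rw [hA, map_mul, h0, mul_zero])

/-- If the reduction of a polynomial over a valuation ring of an algebraically closed field is
separable, then its roots in the valuation ring correspond to those of the reduction. -/
theorem ncard_setOf_eval_eq_zero {Q : A[X]} (hQ : (Q.map (residue A)).Separable) :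
    {x : A | Q.eval x = 0}.ncard = {y | (Q.map (residue A)).eval y = 0}.ncard := by
  have hev (x : A) : (Q.map (residue A)).eval (residue A x) = residue A (Q.eval x) :=
    eval_map_apply (residue A) x
  have hder (x : A) (h : residue A (Q.eval x) = 0) : residue A (Q.derivative.eval x) ≠ 0 := by
    have := hQ.eval₂_derivative_ne_zero (RingHom.id _) (x := residue A x)
      (by rw [← hev] at h; simpa using h)
    rw [derivative_map, eval₂_id, eval_map_apply] at this
    exact this
  refine Set.ncard_congr (fun x _ => residue A x) ?_ ?_ ?_
  · intro x hx
    rw [Set.mem_ofPred_eq, hev, show Q.eval x = 0 from hx, map_zero]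
  · intro x y hx hy hxy
    -- For two roots with the same residue, the Taylor expansion gives `(Q'(x) + k (y - x)) (y - x)
    -- = 0`, and the first factor is a unit.
    obtain ⟨k, hk⟩ := Q.binomExpansion x (y - x)
    rw [add_sub_cancel, show Q.eval y = 0 from hy, show Q.eval x = 0 from hx] at hk
    have hu : IsUnit (Q.derivative.eval x + k * (y - x)) := by
      rw [← residue_ne_zero_iff_isUnit, map_add, map_mul, map_sub, ← hxy, sub_self, mul_zero,
        add_zero]
      exact hder x (by rw [show Q.eval x = 0 from hx, map_zero])
    have h0 : (Q.derivative.eval x + k * (y - x)) * (y - x) = 0 := by linear_combination -hk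
    exact (sub_eq_zero.1 ((hu.mul_right_eq_zero).1 h0)).symm
  · intro y hy
    obtain ⟨x, rfl⟩ := residue_surjective y
    rw [Set.mem_ofPred_eq, hev] at hy
    obtain ⟨r, hr, hrx⟩ := A.exists_eval_eq_zero_of_residue hy (hder x hy)
    exact ⟨r, hr, hrx⟩

/-- A monic lift of the polynomial has a root in `L`; it is integral over `A`, hence in `A`, since
valuation rings are integrally closed. -/
instance isAlgClosed_residueField : IsAlgClosed (ResidueField A) := by
  refine IsAlgClosed.of_exists_root _ fun p hp hirr => ?_
  obtain ⟨q, hq, hdeg, hmon⟩ := lifts_and_natDegree_eq_and_monic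
    ((lifts_iff_coeff_lifts p).2 fun n => residue_surjective _) hp
  have hd : (q.map (algebraMap A L)).degree ≠ 0 := by
    rw [hmon.degree_map, degree_eq_natDegree hmon.ne_zero, hdeg]
    exact_mod_cast hirr.natDegree_pos.ne'
  obtain ⟨z, hz⟩ := IsAlgClosed.exists_root _ hd
  have hint : IsIntegral A z := ⟨q, hmon, by rwa [IsRoot, eval_map] at hz⟩
  obtain ⟨x, rfl⟩ := IsIntegrallyClosed.isIntegral_iff.1 hint
  refine ⟨residue A x, ?_⟩
  rw [IsRoot, eval_map_apply] at hz
  have : q.eval x = 0 := (FaithfulSMul.algebraMap_injective A L) (by simpa using hz)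
  rw [← hq, eval_map_apply, this, map_zero]

end ValuationSubring

theorem IsAlgClosed.ncard_setOf_pow_eq_one (k : Type*) [Field k] [IsAlgClosed k] (n : ℕ)
    [NeZero (n : k)] : {y : k | y ^ n = 1}.ncard = n := by
  have : NeZero n := .of_neZero_natCast k
  obtain ⟨ζ, hζ⟩ := HasEnoughRootsOfUnity.exists_primitiveRoot k n
  have hset : {y : k | y ^ n = 1} = nthRootsFinset n (1 : k) := by
    ext y
    simp [mem_nthRootsFinset (NeZero.pos n)]
  rw [hset, Set.ncard_coe_finset, hζ.card_nthRootsFinset]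

/-! ### Additive valuations and residues -/

namespace AddValuation

variable {F : Type*} [Field F] (w : AddValuation F (WithTop ℝ))

theorem residue_eq_zero_iff {x : (toValuation w).valuationSubring} :
    residue _ x = 0 ↔ 0 < w x := by
  rw [IsLocalRing.residue_eq_zero_iff, Valuation.mem_maximalIdeal_iff]
  exact Iff.rfl

theorem map_eq_zero_of_residue_ne_zero {x : (toValuation w).valuationSubring}
    (hx : residue _ x ≠ 0) : w x = 0 :=
  le_antisymm (not_lt.1 fun h => hx ((residue_eq_zero_iff w).2 h)) x.2

theorem map_natCast_eq_zero_of_residueChar_ne {p : ℕ} (hp : p.Prime) (h : residueChar w ≠ p) :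
    w p = 0 := by
  refine map_eq_zero_of_residue_ne_zero w (x := (p : (toValuation w).valuationSubring))
    fun h0 => ?_
  rw [map_natCast, ringChar.spec] at h0
  exact ((Nat.dvd_prime hp).1 h0).elim CharP.ringChar_ne_one h

theorem one_sub_mul_ne_zero {c x : F} (hc : 0 ≤ w c) (hx : 0 < w x) : 1 - c * x ≠ 0 := by
  intro h
  have h' := congrArg w (sub_eq_zero.1 h)
  rw [AddValuation.map_one, AddValuation.map_mul] at h'
  exact (hx.trans_le (le_add_of_nonneg_left hc)).ne h'

end AddValuation

theorem WithTop.eq_coe_neg_div_of_add_nsmul_eq_zero {x : WithTop ℝ} {t : ℝ} {n : ℕ} (hn : n ≠ 0)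
    (h : (t : WithTop ℝ) + n • x = 0) : x = ((-t / n : ℝ) : WithTop ℝ) := by
  have hn' : (n : ℝ) ≠ 0 := Nat.cast_ne_zero.2 hn
  induction x with
  | top =>
    obtain ⟨m, rfl⟩ := Nat.exists_eq_succ_of_ne_zero hn
    simp [succ_nsmul] at h
  | coe x =>
    have h' : t + n • x = 0 := by exact_mod_cast h
    rw [WithTop.coe_inj, eq_div_iff hn']
    rw [nsmul_eq_mul] at h'
    linarith

/-! ### Invariants of the symmetric cubic and the equation `j = ι` -/

namespace TernaryCubic

section Ring

variable {R : Type*} [CommRing R]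

/-- The invariant `c₄` of `symmetricCubic a b`. -/
def symmetricC₄ (a b : R) : R :=
  1 - 216 * a ^ 3 + (72 * a + 432 * a ^ 2 - 24) * b ^ 2 + (48 - 288 * a) * b ^ 3

/-- When `a = k ^ 2 * g`, this is the discriminant of `symmetricCubic a (k * u)` divided
by `k ^ 6`. -/
def scaledDisc (a k g u : R) : R :=
  (1 + 3 * a + 6 * (k * u)) * (1 + 3 * a - 3 * (k * u)) ^ 2 *
    (u ^ 2 * (1 - 2 * (k * u) + 3 * a) - g * (1 - 3 * a + 9 * a ^ 2)) ^ 3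

theorem c₄_symmetricCubic (a b : R) : (symmetricCubic a b).c₄ = symmetricC₄ a b := by
  simp only [c₄, symmetricCubic, symmetricC₄]
  ring

theorem map_symmetricC₄ {S : Type*} [CommRing S] (φ : R →+* S) (a b : R) :
    φ (symmetricC₄ a b) = symmetricC₄ (φ a) (φ b) := by
  simp [symmetricC₄, map_ofNat]

theorem map_scaledDisc {S : Type*} [CommRing S] (φ : R →+* S) (a k g u : R) :
    φ (scaledDisc a k g u) = scaledDisc (φ a) (φ k) (φ g) (φ u) := by
  simp [scaledDisc, map_ofNat]

/-- The equation of the `j`-invariant for `symmetricCubic a (k * X)`, with `a = k ^ 2 * g` and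
`e = k ^ 6 * j`. -/
noncomputable def jPolynomial (a k g e : R) : R[X] :=
  symmetricC₄ (C a) (C k * X) ^ 3 - C e * scaledDisc (C a) (C k) (C g) X

theorem eval_jPolynomial (a k g e u : R) :
    (jPolynomial a k g e).eval u =
      symmetricC₄ a (k * u) ^ 3 - e * scaledDisc a k g u := by
  rw [← coe_evalRingHom, jPolynomial, map_sub, map_mul, map_pow, map_symmetricC₄, map_scaledDisc]
  simp

theorem map_jPolynomial {S : Type*} [CommRing S] (φ : R →+* S) (a k g e : R) :
    (jPolynomial a k g e).map φ = jPolynomial (φ a) (φ k) (φ g) (φ e) := by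
  rw [← coe_mapRingHom, jPolynomial, map_sub, map_mul, map_pow, map_symmetricC₄, map_scaledDisc]
  simp [jPolynomial]

theorem map_eval_jPolynomial {S : Type*} [CommRing S] (φ : R →+* S) (a k g e u : R) :
    φ ((jPolynomial a k g e).eval u) = (jPolynomial (φ a) (φ k) (φ g) (φ e)).eval (φ u) := by
  rw [← map_jPolynomial, eval_map_apply]

theorem natDegree_jPolynomial {a k g e : R} (h : 432 * e * k ^ 6 ≠ 0) :
    (jPolynomial a k g e).natDegree = 12 := by
  have h₁ : (symmetricC₄ (C a) (C k * X)).natDegree ≤ 3 := by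
    rw [symmetricC₄]
    compute_degree
  have h₂ : (symmetricC₄ (C a) (C k * X) ^ 3).coeff 12 = 0 :=
    coeff_eq_zero_of_natDegree_lt ((natDegree_pow_le_of_le 3 h₁).trans_lt (by norm_num))
  have h₃ : (scaledDisc (C a) (C k) (C g) X).natDegree ≤ 12 := by
    rw [scaledDisc]
    compute_degree
  -- Product of the leading coefficients of the factors: `6k · (-3k)² · (-2k)³`.
  have h₄ : (scaledDisc (C a) (C k) (C g) X).coeff 12 = -432 * k ^ 6 := by
    rw [scaledDisc]
    compute_degree
    · ring
    all_goals simp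
  refine le_antisymm ?_ (le_natDegree_of_ne_zero ?_)
  · rw [jPolynomial]
    exact (natDegree_sub_le _ _).trans (max_le
      ((natDegree_pow_le_of_le 3 h₁).trans (by norm_num)) ((natDegree_C_mul_le _ _).trans h₃))
  · rw [jPolynomial, coeff_sub, h₂, coeff_C_mul, h₄]
    convert h using 1
    ring

theorem jPolynomial_zero : jPolynomial (0 : R) 0 0 1 = 1 - X ^ 6 := by
  simp only [jPolynomial, symmetricC₄, scaledDisc, map_zero, map_one]
  ring

end Ring

section Field

variable {F : Type*} [Field F]

theorem disc_symmetricCubic (h6 : (6 : F) ≠ 0) (k g u : F) :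
    (symmetricCubic (k ^ 2 * g) (k * u)).disc = k ^ 6 * scaledDisc (k ^ 2 * g) k g u := by
  have h : (1728 : F) ≠ 0 := by
    rw [show (1728 : F) = 6 ^ 3 * 2 ^ 3 by norm_num]
    refine mul_ne_zero (pow_ne_zero _ h6) (pow_ne_zero _ fun h2 => h6 ?_)
    linear_combination 3 * h2
  rw [disc, div_eq_iff h]
  simp only [c₄, c₆, symmetricCubic, scaledDisc]
  ring

theorem disc_symmetricCubic' (h6 : (6 : F) ≠ 0) (a b : F) :
    (symmetricCubic a b).disc = scaledDisc a 1 a b := by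
  simpa using disc_symmetricCubic h6 1 a b

/-- Modulo each factor of the discriminant, `(1 - 6a)⁴` is a multiple of `c₄`: of `9 c₄` for the two
linear factors and of `c₄` itself for the cubic one. -/
theorem disc_symmetricCubic_ne_zero {a b : F} (h6 : (6 : F) ≠ 0) (ha : 1 - 6 * a ≠ 0)
    (h : (symmetricCubic a b).c₄ = 0) : (symmetricCubic a b).disc ≠ 0 := by
  rw [c₄_symmetricCubic, symmetricC₄] at h
  rw [disc_symmetricCubic' h6, scaledDisc]
  have h4 : (1 - 6 * a) ^ 4 ≠ 0 := pow_ne_zero _ ha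
  refine mul_ne_zero (mul_ne_zero ?_ (pow_ne_zero _ ?_)) (pow_ne_zero _ ?_) <;>
    refine fun h0 => h4 ?_
  · linear_combination 9 * h - (8 - 48 * b + 72 * b ^ 2 + 144 * a * b - 432 * a * b ^ 2
      - 216 * a ^ 2 + 864 * a ^ 2 * b - 432 * a ^ 3) * h0
  · linear_combination 9 * h - (8 + 24 * b - 144 * b ^ 2 - 72 * a * b + 864 * a * b ^ 2
      - 216 * a ^ 2 - 432 * a ^ 2 * b - 432 * a ^ 3) * h0
  · linear_combination h - (144 * a - 24) * h0

theorem hasJInvariant_symmetricCubic_iff {a b j : F} (h6 : (6 : F) ≠ 0) (ha : 1 - 6 * a ≠ 0) :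
    (symmetricCubic a b).HasJInvariant j ↔
      (symmetricCubic a b).c₄ ^ 3 - j * (symmetricCubic a b).disc = 0 := by
  rw [HasJInvariant, jInvariant]
  refine ⟨fun ⟨hd, hj⟩ => by rwa [div_eq_iff hd, ← sub_eq_zero] at hj, fun h => ?_⟩
  have hd : (symmetricCubic a b).disc ≠ 0 := fun hd =>
    disc_symmetricCubic_ne_zero h6 ha (by simpa [hd] using h) hd
  exact ⟨hd, by rwa [div_eq_iff hd, ← sub_eq_zero]⟩

theorem hasJInvariant_symmetricCubic_iff_eval {k g u j : F} (h6 : (6 : F) ≠ 0)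
    (ha : 1 - 6 * (k ^ 2 * g) ≠ 0) :
    (symmetricCubic (k ^ 2 * g) (k * u)).HasJInvariant j ↔
      (jPolynomial (k ^ 2 * g) k g (j * k ^ 6)).eval u = 0 := by
  rw [hasJInvariant_symmetricCubic_iff h6 ha, disc_symmetricCubic h6, c₄_symmetricCubic,
    eval_jPolynomial, mul_assoc]

/-! ### Honeycomb form and the valuation of `b` -/

variable (w : AddValuation F (WithTop ℝ))

theorem isSymmetricHoneycomb_symmetricCubic_iff {a b : F} :
    (symmetricCubic a b).IsSymmetricHoneycomb w ↔ b ≠ 0 ∧ 0 < w b ∧ 0 < w (a / b ^ 2) := by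
  have hb (hb : b ≠ 0) : b * b / b = b := mul_div_cancel_right₀ b hb
  constructor
  · rintro ⟨⟨-, h0, -⟩, ⟨p, hp, h⟩, q, hq, h'⟩
    have h₁ := h 0
    have h₂ := h' 0
    simp only [hexagonRatios, legRatios, symmetricCubic, Matrix.cons_val_zero, one_mul] at h0 h₁ h₂
    rw [hb h0] at h₁
    rw [← sq] at h₂
    exact ⟨h0, h₁ ▸ hp, h₂ ▸ hq⟩
  · rintro ⟨h0, h₁, h₂⟩
    refine ⟨⟨one_ne_zero, h0, h0, h0, h0, h0, h0⟩, ⟨_, h₁, fun i => ?_⟩, _, h₂, fun i => ?_⟩ <;>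
      fin_cases i <;> simp [hexagonRatios, legRatios, symmetricCubic, hb h0, sq]

theorem map_add_nsmul_map_of_isSymmetricHoneycomb {a b j : F} (h6 : (6 : F) ≠ 0)
    (hj : (symmetricCubic a b).HasJInvariant j)
    (hs : (symmetricCubic a b).IsSymmetricHoneycomb w) : w j + 6 • w b = 0 := by
  obtain ⟨h0, h₁, h₂⟩ := (isSymmetricHoneycomb_symmetricCubic_iff w).1 hs
  -- Here the scaling factor is `b` itself, with `u = 1`. Since `k` and `g` reduce to zero, both
  -- `symmetricC₄` and `scaledDisc` reduce to 1.
  let k : (AddValuation.toValuation w).valuationSubring := ⟨b, h₁.le⟩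
  let g : (AddValuation.toValuation w).valuationSubring := ⟨a / b ^ 2, h₂.le⟩
  have hk : residue _ k = 0 := (AddValuation.residue_eq_zero_iff w).2 h₁
  have hg : residue _ g = 0 := (AddValuation.residue_eq_zero_iff w).2 h₂
  have hab : b ^ 2 * (a / b ^ 2) = a := mul_div_cancel₀ a (pow_ne_zero 2 h0)
  have hc : w (symmetricC₄ (k ^ 2 * g) k :) = 0 := by
    apply AddValuation.map_eq_zero_of_residue_ne_zero
    rw [map_symmetricC₄, map_mul, map_pow, hk, hg]
    simp [symmetricC₄]
  have hd : w (scaledDisc (k ^ 2 * g) k g 1 :) = 0 := by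
    apply AddValuation.map_eq_zero_of_residue_ne_zero
    rw [map_scaledDisc, map_mul, map_pow, hk, hg]
    simp [scaledDisc]
  have hcoe : ((symmetricC₄ (k ^ 2 * g) k :) : F) = (symmetricCubic a b).c₄ := by
    refine (map_symmetricC₄ (ValuationSubring.subtype _) _ _).trans ?_
    change symmetricC₄ (b ^ 2 * (a / b ^ 2)) b = _
    rw [hab, c₄_symmetricCubic]
  have hdcoe : ((scaledDisc (k ^ 2 * g) k g 1 :) : F) * b ^ 6 = (symmetricCubic a b).disc := by
    refine (congrArg (· * b ^ 6) (map_scaledDisc (ValuationSubring.subtype _) _ _ _ _)).trans ?_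
    change scaledDisc (b ^ 2 * (a / b ^ 2)) b (a / b ^ 2) 1 * b ^ 6 = _
    rw [mul_comm, ← disc_symmetricCubic h6, mul_one, hab]
  rw [hcoe] at hc
  have heq := congrArg w ((div_eq_iff hj.1).1 hj.2)
  rw [← hdcoe] at heq
  simp only [hc, hd, AddValuation.map_mul, AddValuation.map_pow] at heq
  simpa using heq.symm

/-- The reduced equation is `1 - x⁶ = 0`, which excludes residue zero. -/
theorem map_eq_zero_of_eval_jPolynomial_eq_zero
    {k g x : (AddValuation.toValuation w).valuationSubring}
    (hk : residue _ k = 0) (hg : residue _ g = 0)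
    (hx : (jPolynomial (k ^ 2 * g) k g 1).eval x = 0) : w x = 0 := by
  refine AddValuation.map_eq_zero_of_residue_ne_zero w fun h => ?_
  have hmap := congrArg (residue _) hx
  rw [← eval_map_apply, map_jPolynomial, map_mul, map_pow, hk, hg, map_one, mul_zero,
    jPolynomial_zero, h] at hmap
  simp at hmap

end Field

end TernaryCubic

/-! ### Counting the solutions -/

namespace TernaryCubic

variable {L : Type*} [Field L] [IsAlgClosed L] (w : AddValuation L (WithTop ℝ))

theorem ncard_setOf_eval_jPolynomial_eq_zero {k g : (AddValuation.toValuation w).valuationSubring}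
    (hk : residue _ k = 0) (hg : residue _ g = 0) (h6 : w 6 = 0) :
    {x | (jPolynomial (k ^ 2 * g) k g 1).eval x = 0}.ncard = 6 := by
  have hmap : (jPolynomial (k ^ 2 * g) k g 1).map (residue _) = 1 - X ^ 6 := by
    rw [map_jPolynomial, map_mul, map_pow, hk, hg, map_one, mul_zero, jPolynomial_zero]
  have h6' : ((6 : ℕ) : ResidueField (AddValuation.toValuation w).valuationSubring) ≠ 0 := by
    intro h
    rw [← map_natCast (residue (AddValuation.toValuation w).valuationSubring),
      AddValuation.residue_eq_zero_iff] at h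
    refine h.ne' (h6 ▸ congrArg w ?_)
    exact (map_natCast (AddValuation.toValuation w).valuationSubring.subtype 6).trans Nat.cast_ofNat
  have : NeZero ((6 : ℕ) : ResidueField (AddValuation.toValuation w).valuationSubring) := ⟨h6'⟩
  rw [ValuationSubring.ncard_setOf_eval_eq_zero, hmap]
  · convert IsAlgClosed.ncard_setOf_pow_eq_one
      (ResidueField (AddValuation.toValuation w).valuationSubring) 6 using 3
    ext y
    rw [eval_sub, eval_one, eval_pow, eval_X, sub_eq_zero, eq_comm]
  · rw [hmap]
    refine (separable_X_pow_sub_C 1 h6' one_ne_zero).of_dvd ⟨-1, ?_⟩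
    rw [C_1]
    ring

theorem ncard_setOf_hasJInvariant_and_isSymmetricHoneycomb {a j : L} (h6 : w 6 = 0)
    (hj : w j < 0) (ha : 0 < w a + w j) :
    {b : L | (symmetricCubic a b).HasJInvariant j ∧
      (symmetricCubic a b).IsSymmetricHoneycomb w}.ncard = 6 := by
  have h6L : (6 : L) ≠ 0 := by
    intro h
    rw [h, AddValuation.map_zero] at h6
    exact WithTop.top_ne_zero h6
  have hj0 : j ≠ 0 := by
    rintro rfl
    rw [AddValuation.map_zero] at hj
    exact not_top_lt hj
  obtain ⟨t, ht⟩ := WithTop.ne_top_iff_exists.1 hj.ne_top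
  have ht0 : t < 0 := by exact_mod_cast ht ▸ hj
  -- This scaling makes the parameter `e = j c⁶` of `jPolynomial` equal to 1.
  obtain ⟨c, hc⟩ := IsAlgClosed.exists_pow_nat_eq j⁻¹ (n := 6) (by norm_num)
  have hjc : j * c ^ 6 = 1 := by rw [hc, mul_inv_cancel₀ hj0]
  have hc0 : c ≠ 0 := by
    rintro rfl
    simp at hjc
  have hwc : w c = ((-t / 6 : ℝ) : WithTop ℝ) := by
    have := congrArg w hjc
    rw [AddValuation.map_mul, AddValuation.map_pow, AddValuation.map_one, ← ht] at this
    exact_mod_cast WithTop.eq_coe_neg_div_of_add_nsmul_eq_zero (by norm_num) this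
  have hwc0 : 0 < w c := by
    rw [hwc, WithTop.coe_pos]
    linarith
  have hca : c ^ 2 * (a / c ^ 2) = a := mul_div_cancel₀ a (pow_ne_zero 2 hc0)
  -- The valuation is `val a + t / 3`, which exceeds `-2t / 3 > 0`.
  have hwg : 0 < w (a / c ^ 2) := by
    have h := congrArg w hca
    rw [AddValuation.map_mul, AddValuation.map_pow, hwc] at h
    rw [← h, ← ht] at ha
    generalize w (a / c ^ 2) = s at ha ⊢
    induction s with
    | top => exact WithTop.top_pos
    | coe s =>
      rw [← WithTop.coe_nsmul, ← WithTop.coe_add, ← WithTop.coe_add, WithTop.coe_pos] at ha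
      rw [WithTop.coe_pos]
      simp only [nsmul_eq_mul, Nat.cast_ofNat] at ha
      linarith
  have ha6 : 1 - 6 * (c ^ 2 * (a / c ^ 2)) ≠ 0 := by
    rw [hca]
    exact w.one_sub_mul_ne_zero h6.ge (not_le.1 fun h => ha.not_ge (add_nonpos h hj.le))
  obtain ⟨k, hkc⟩ : ∃ k : (AddValuation.toValuation w).valuationSubring, (k : L) = c :=
    ⟨⟨c, hwc0.le⟩, rfl⟩
  obtain ⟨g, hgc⟩ : ∃ g : (AddValuation.toValuation w).valuationSubring, (g : L) = a / c ^ 2 :=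
    ⟨⟨a / c ^ 2, hwg.le⟩, rfl⟩
  have hk : residue _ k = 0 := (AddValuation.residue_eq_zero_iff w).2 (hkc ▸ hwc0)
  have hg : residue _ g = 0 := (AddValuation.residue_eq_zero_iff w).2 (hgc ▸ hwg)
  have hev (x : (AddValuation.toValuation w).valuationSubring) :
      (symmetricCubic a (c * x)).HasJInvariant j ↔
        (jPolynomial (k ^ 2 * g) k g 1).eval x = 0 := by
    have h := hasJInvariant_symmetricCubic_iff_eval (k := c) (g := a / c ^ 2) (u := x) (j := j)
      h6L ha6
    rw [hca, hjc] at h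
    rw [h]
    have hx := map_eval_jPolynomial (ValuationSubring.subtype _) (k ^ 2 * g) k g 1 x
    simp only [map_mul, map_pow, map_one, ValuationSubring.subtype_apply, hkc, hgc, hca] at hx
    rw [← hx]
    exact ZeroMemClass.coe_eq_zero
  rw [← ncard_setOf_eval_jPolynomial_eq_zero w hk hg h6]
  symm
  refine Set.ncard_congr (fun x _ => c * x) ?_ ?_ ?_
  · intro x hx
    have hwx := map_eq_zero_of_eval_jPolynomial_eq_zero w hk hg hx
    have hx0 : (x : L) ≠ 0 := by
      intro h
      rw [h, AddValuation.map_zero] at hwx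
      exact WithTop.top_ne_zero hwx
    refine ⟨(hev x).2 hx, (isSymmetricHoneycomb_symmetricCubic_iff w).2
      ⟨mul_ne_zero hc0 hx0, ?_, ?_⟩⟩
    · rwa [AddValuation.map_mul, hwx, add_zero]
    · have h : w (a / (c * x) ^ 2 * x ^ 2) = w (a / c ^ 2) := by
        congr 1
        field_simp
      rw [AddValuation.map_mul, AddValuation.map_pow, hwx, nsmul_zero, add_zero] at h
      rwa [h]
  · intro x y _ _ hxy
    exact Subtype.ext (mul_left_cancel₀ hc0 hxy)
  -- Surjectivity: honeycomb form forces `b` and `c` to have equal valuation, so `b / c` lies in the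
  -- valuation ring.
  · rintro b ⟨hb, hs⟩
    have hwb := map_add_nsmul_map_of_isSymmetricHoneycomb w h6L hb hs
    rw [← ht] at hwb
    have hwb' : w b = w c := by
      rw [hwc]
      exact_mod_cast WithTop.eq_coe_neg_div_of_add_nsmul_eq_zero (by norm_num) hwb
    have hcb : c * (b / c) = b := mul_div_cancel₀ b hc0
    have hmem : 0 ≤ w (b / c) := by
      have h := congrArg w hcb
      rw [AddValuation.map_mul, hwb', hwc] at h
      generalize w (b / c) = s at h ⊢
      induction s with
      | top => exact le_top
      | coe s =>
        have h' : -t / 6 + s = -t / 6 := by exact_mod_cast h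
        exact_mod_cast (by linarith : (0 : ℝ) ≤ s)
    refine ⟨⟨b / c, hmem⟩, (hev _).1 ?_, hcb⟩
    change (symmetricCubic a (c * (b / c))).HasJInvariant j
    rwa [hcb]

end TernaryCubic

/-! ### The proposition over `K` and its algebraic closure -/

theorem proposition1
    {K : Type*} [Field K] {L : Type*} [Field L] [Algebra K L] [IsAlgClosure K L]
    (v : AddValuation K (WithTop ℝ)) (w : AddValuation L (WithTop ℝ))
    (hw : ∀ x : K, w (algebraMap K L x) = v x)
    (h2 : residueChar v ≠ 2) (h3 : residueChar v ≠ 3)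
    (ι a : K) (hι : v ι < 0) (ha : 0 < v a + v ι) :
    -- there are exactly six such `b`
    {b : L | (TernaryCubic.symmetricCubic (algebraMap K L a) b).HasJInvariant (algebraMap K L ι) ∧
        (TernaryCubic.symmetricCubic (algebraMap K L a) b).IsSymmetricHoneycomb w}.ncard = 6 ∧
    -- the condition on the `j`-invariant is an equation of degree 12 for `b` over `K`, obtained
    -- from `j(g) = ι` by clearing the denominator
    (∃ P : Polynomial K, P.natDegree = 12 ∧
      (∀ b : L, Polynomial.aeval b P =
        (TernaryCubic.symmetricCubic (algebraMap K L a) b).c₄ ^ 3 -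
          algebraMap K L ι * (TernaryCubic.symmetricCubic (algebraMap K L a) b).disc) ∧
      (∀ b : L, Polynomial.aeval b P = 0 ↔
        (TernaryCubic.symmetricCubic (algebraMap K L a) b).HasJInvariant (algebraMap K L ι))) ∧
    -- the six solutions have valuation `-val(ι)/6`
    (∃ t : ℝ, v ι = (t : WithTop ℝ) ∧
      ∀ b : L, (TernaryCubic.symmetricCubic (algebraMap K L a) b).HasJInvariant (algebraMap K L ι) →
        (TernaryCubic.symmetricCubic (algebraMap K L a) b).IsSymmetricHoneycomb w →
        w b = ((-t / 6 : ℝ) : WithTop ℝ)) := by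
  have : IsAlgClosed L := IsAlgClosure.isAlgClosed K
  have h6v : v 6 = 0 := by
    have h2' := v.map_natCast_eq_zero_of_residueChar_ne Nat.prime_two h2
    have h3' := v.map_natCast_eq_zero_of_residueChar_ne Nat.prime_three h3
    rw [show (6 : K) = (2 : ℕ) * (3 : ℕ) by norm_num, AddValuation.map_mul, h2', h3', add_zero]
  have h6 : w 6 = 0 := by rw [← h6v, ← hw, map_ofNat (algebraMap K L)]
  have h6K : (6 : K) ≠ 0 := v.top_iff.not.1 (h6v ▸ WithTop.zero_ne_top)
  have h6L : (6 : L) ≠ 0 := w.top_iff.not.1 (h6 ▸ WithTop.zero_ne_top)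
  have hιK : ι ≠ 0 := v.top_iff.not.1 hι.ne_top
  -- The hypotheses force `val a > 0`, so `6 a` cannot equal 1.
  have haL : 1 - 6 * algebraMap K L a ≠ 0 := by
    refine w.one_sub_mul_ne_zero h6.ge ?_
    rw [hw]
    exact not_le.1 fun h => ha.not_ge (add_nonpos h hι.le)
  -- The polynomial `P` is the unscaled case `k = 1`, `g = a`, which is defined over `K` without a
  -- sixth root of `ι⁻¹`.
  have haeval (b : L) : Polynomial.aeval b (TernaryCubic.jPolynomial a 1 a ι) =
      (TernaryCubic.symmetricCubic (algebraMap K L a) b).c₄ ^ 3 -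
        algebraMap K L ι * (TernaryCubic.symmetricCubic (algebraMap K L a) b).disc := by
    rw [← Polynomial.eval_map_algebraMap, TernaryCubic.map_jPolynomial,
      TernaryCubic.eval_jPolynomial, map_one, one_mul, TernaryCubic.c₄_symmetricCubic,
      TernaryCubic.disc_symmetricCubic' h6L]
  obtain ⟨t, ht⟩ := WithTop.ne_top_iff_exists.1 hι.ne_top
  refine ⟨TernaryCubic.ncard_setOf_hasJInvariant_and_isSymmetricHoneycomb w h6 (by rwa [hw])
    (by rwa [hw, hw]), ⟨TernaryCubic.jPolynomial a 1 a ι, ?_, haeval, fun b => ?_⟩, t, ht.symm,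
    fun b hj hs => ?_⟩
  · refine TernaryCubic.natDegree_jPolynomial ?_
    rw [one_pow, mul_one]
    refine mul_ne_zero ?_ hιK
    rw [show (432 : K) = 6 ^ 3 * 2 by norm_num]
    refine mul_ne_zero (pow_ne_zero _ h6K) fun h => h6K ?_
    linear_combination 3 * h
  · rw [haeval, TernaryCubic.hasJInvariant_symmetricCubic_iff h6L haL]
  · have h := TernaryCubic.map_add_nsmul_map_of_isSymmetricHoneycomb w h6L hj hs
    rw [hw, ← ht] at h
    exact_mod_cast WithTop.eq_coe_neg_div_of_add_nsmul_eq_zero (by norm_num) h
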